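/- Consider $n$ agents at positions $x_1(t),\dots,x_n(t)\in\mathbb{R}^d$, $t=0,1,2,\dots$, an arbitrary subset $C$ of which is closed-minded (confidence radius $0$); all others have confidence radius $1$. Let $N_i(t)=\{j : \|x_i(t)-x_j(t)\|_2\le 1\}$; these neighbor sets form the (undirected) communication network $G_t$ on all $n$ agents. The dynamics is $x_i(t+1)=x_i(t)$ for $i\in C$ and $x_i(t+1)=\frac{1}{|N_i(t)|}\sum_{j\in N_i(t)}x_j(t)$ for $i\notin C$. Then: (1) For every initial configuration, $x(t)=(x_1(t),\dots,x_n(t))$ converges as $t\to\infty$ to a fixed configuration $z\in(\mathbb{R}^d)^n$. For all sufficiently large $t$, $z$ is a fixed point of the averaging rule of the network $G_t$, that is, $z_i=\frac{1}{|N_i(t)|}\sum_{j\in N_i(t)}z_j$ for all $i\notin C$. (2) If $d=1$, then for every initial configuration the communication network converges: there are a graph $G$ and a time $T$ with $G_t=G$ for all $t\ge T$. (3) If $d>1$, then the communication network converges in the same sense for all initial configurations outside a subset of $(\mathbb{R}^d)^n$ of Lebesgue measure zero. Moreover, for every choice of the initial positions of the agents not in $C$, it converges for all initial positions of the closed-minded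 agents outside a subset of $(\mathbb{R}^d)^C$ of Lebesgue measure zero. -/

import Mathlib

namespace HK

/-- The opinion space `ℝ^d` with the Euclidean norm. -/
abbrev Space (d : ℕ) : Type := EuclideanSpace ℝ (Fin d)

/-- A configuration: the positions of the `n` agents in `ℝ^d`. -/
abbrev Config (n d : ℕ) : Type := Fin n → Space d

/-- The communication network of a configuration, given by its neighbor sets
`N i = {j | ‖x i - x j‖ ≤ 1}`. The neighbor relation is symmetric and every agent is its own
neighbor; mobile and closed-minded agents are treated alike. -/
noncomputable def network {n d : ℕ} (x : Config n d) : Fin n → Finset (Fin n) :=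
  fun i => Finset.univ.filter fun j => ‖x i - x j‖ ≤ 1

/-- One averaging step along a network with neighbor sets `N`: the agents in `C` (the closed-minded
ones) stay in place, every other agent moves to the mass center of its neighbors. -/
noncomputable def average {n d : ℕ} (C : Finset (Fin n)) (N : Fin n → Finset (Fin n))
    (x : Config n d) : Config n d :=
  fun i => if i ∈ C then x i else ((N i).card : ℝ)⁻¹ • ∑ j ∈ N i, x j

/-- One step of the Hegselmann-Krause system with set `C` of closed-minded agents. -/
noncomputable def step {n d : ℕ} (C : Finset (Fin n)) (x : Config n d) : Config n d :=
  average C (network x) x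

/-- The step in terms of confidence radii, `0` for closed-minded agents and `1` for the others:
every agent moves to the mass center of the agents within its own confidence radius. -/
theorem step_eq_mean_within_radius {n d : ℕ} (C : Finset (Fin n)) (x : Config n d) (i : Fin n) :
    step C x i =
      ((Finset.univ.filter fun j => ‖x i - x j‖ ≤ if i ∈ C then 0 else 1).card : ℝ)⁻¹ •
        ∑ j ∈ Finset.univ.filter (fun j => ‖x i - x j‖ ≤ if i ∈ C then 0 else 1), x j := by
  by_cases h : i ∈ C
  · simp only [step, average, h, if_true]
    set S := Finset.univ.filter fun j => ‖x i - x j‖ ≤ 0 with hS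
    have hi : i ∈ S := by simp [hS]
    have hsum : ∑ j ∈ S, x j = ∑ _j ∈ S, x i := by
      refine Finset.sum_congr rfl fun j hj => ?_
      have h0 : ‖x i - x j‖ ≤ 0 := (Finset.mem_filter.mp hj).2
      exact (sub_eq_zero.mp (norm_le_zero_iff.mp h0)).symm
    have hc : (S.card : ℝ) ≠ 0 := by
      exact_mod_cast (Finset.card_pos.mpr ⟨i, hi⟩).ne'
    rw [hsum, Finset.sum_const, ← Nat.cast_smul_eq_nsmul ℝ, smul_smul, inv_mul_cancel₀ hc, one_smul]
  · simp only [step, average, network, h, if_false]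

/-- The configuration at time `t`, started from `x₀` at time `0`. -/
noncomputable def trajectory {n d : ℕ} (C : Finset (Fin n)) (x₀ : Config n d) (t : ℕ) :
    Config n d :=
  (step C)^[t] x₀

/-- The communication network settles to a fixed graph in finite time. -/
def NetworkConverges {n d : ℕ} (C : Finset (Fin n)) (x₀ : Config n d) : Prop :=
  ∃ N : Fin n → Finset (Fin n), ∃ T : ℕ, ∀ t ≥ T, network (trajectory C x₀ t) = N

/-- The configuration `x₀` with the closed-minded agents moved to the positions `y`. -/
noncomputable def replaceClosed {n d : ℕ} (C : Finset (Fin n)) (x₀ : Config n d)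
    (y : C → Space d) : Config n d :=
  fun i => if h : i ∈ C then y ⟨i, h⟩ else x₀ i

end HK

/-!
The energy of a configuration `x` relative to a network `N` charges `‖x i - x j‖²` for an edge and
`1` for a non-edge. The communication network of `x` is the one of least energy, and averaging along
a fixed network lowers its energy by at least `4 ∑ ‖Δ i‖²`, where `Δ` is the move
(`IsNetwork.energy_average_le`). So the energy decreases along a trajectory. For a fixed network the
energy is a convex quadratic function of the mobile agents, and `Δ` vanishes exactly where its
gradient does; hence the excess of the energy over its infimum is at most `K ∑ ‖Δ i‖²`
(`exists_energy_sub_le`). Late in a trajectory only networks that recur infinitely often are left,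
and comparison with later visits to the same network bounds the excess over the limit energy by a
multiple of the next decrement. The energy therefore converges geometrically, the moves are
summable, and the trajectory has a limit `z` (`exists_tendsto_trajectory`), which is fixed by every
recurring network (`Recurs.average_eq`).

The network converges once there is a single recurring network. On the line, let `N` and `N'` be
recurring, with late configurations `x` and `x'`. As `z` is fixed by both, Green's identity
(`IsNetwork.dirichlet_eq`) makes the Dirichlet forms of `N` and `N'` vanish at `z` and `x' - x`. In
their difference only edges gained or lost contribute, all with the same strict sign, so there are
none (`network_eq_of_average_eq`).

In any dimension, the difference `z i - z j` along an edge of a recurring network is a linear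
function, depending only on the network and the edge, of the positions of the closed-minded agents
(`IsNetwork.exists_linearMap_eq_sub`). Unless one of these finitely many linear functions has norm
exactly `1`, which happens on a null set (`ae_norm_ne_one`), the edges of each recurring network are
exactly the pairs with `‖z i - z j‖ < 1`.
-/

namespace HK

variable {n d : ℕ}

/-! ### Averaging along a fixed network -/

/-- The properties of the neighbor sets of an actual communication network that the argument uses:
every agent is its own neighbor, and being neighbors is symmetric. -/
structure IsNetwork (N : Fin n → Finset (Fin n)) : Prop where
  self_mem : ∀ i, i ∈ N i
  symm : ∀ {i j}, j ∈ N i → i ∈ N j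

theorem isNetwork_network (x : Config n d) : IsNetwork (network x) where
  self_mem i := by simp [network]
  symm {i j} h := by
    simp only [network, Finset.mem_filter, Finset.mem_univ, true_and] at h ⊢
    rwa [norm_sub_rev]

theorem IsNetwork.mem_comm {N : Fin n → Finset (Fin n)} (hN : IsNetwork N) (i j : Fin n) :
    j ∈ N i ↔ i ∈ N j := ⟨hN.symm, hN.symm⟩

theorem IsNetwork.card_ne_zero {N : Fin n → Finset (Fin n)} (hN : IsNetwork N) (i : Fin n) :
    ((N i).card : ℝ) ≠ 0 := by
  exact_mod_cast (Finset.card_pos.mpr ⟨i, hN.self_mem i⟩).ne'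

/-- Averaging along a fixed network, as a linear map on configurations. -/
noncomputable def averageMap (C : Finset (Fin n)) (N : Fin n → Finset (Fin n)) :
    Config n d →ₗ[ℝ] Config n d where
  toFun := average C N
  map_add' x y := by
    ext1 i
    by_cases hi : i ∈ C <;> simp [average, hi, Finset.sum_add_distrib]
  map_smul' a x := by
    ext1 i
    by_cases hi : i ∈ C
    · simp [average, hi]
    · simp [average, hi, ← Finset.smul_sum, smul_comm a]

theorem average_of_mem {C : Finset (Fin n)} {i : Fin n} (hi : i ∈ C)
    (N : Fin n → Finset (Fin n)) (x : Config n d) : average C N x i = x i := by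
  simp [average, hi]

theorem IsNetwork.sum_sub {N : Fin n → Finset (Fin n)} (hN : IsNetwork N) {C : Finset (Fin n)}
    {i : Fin n} (hi : i ∉ C) (x : Config n d) :
    (∑ j, if j ∈ N i then x i - x j else 0) =
      -((N i).card : ℝ) • (average C N x i - x i) := by
  rw [Finset.sum_ite_mem, Finset.univ_inter, Finset.sum_sub_distrib, Finset.sum_const, average,
    if_neg hi, smul_sub, smul_smul, neg_mul, mul_inv_cancel₀ (hN.card_ne_zero i),
    ← Nat.cast_smul_eq_nsmul ℝ, neg_smul, neg_smul, one_smul]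
  abel

/-! ### The Dirichlet form and the energy of a network -/

/-- The Dirichlet form of the network `N`; every edge is counted in both directions. -/
noncomputable def dirichlet (N : Fin n → Finset (Fin n)) (x u : Config n d) : ℝ :=
  ∑ i, ∑ j, if j ∈ N i then inner ℝ (x i - x j) (u i - u j) else 0

/-- The energy of a configuration relative to a network `N`, which need not be the network of that
configuration: the squared edge lengths, plus `1` for each ordered pair of non-neighbors. -/
noncomputable def energy (N : Fin n → Finset (Fin n)) (x : Config n d) : ℝ :=
  ∑ i, ∑ j, if j ∈ N i then ‖x i - x j‖ ^ 2 else 1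

theorem energy_nonneg (N : Fin n → Finset (Fin n)) (x : Config n d) : 0 ≤ energy N x := by
  refine Finset.sum_nonneg fun i _ => Finset.sum_nonneg fun j _ => ?_
  split_ifs <;> positivity

/-- Among all networks, the communication network of `x` minimizes the energy of `x`, because
each pair contributes `min 1 (‖x i - x j‖ ^ 2)` there. -/
theorem energy_network_le (N : Fin n → Finset (Fin n)) (x : Config n d) :
    energy (network x) x ≤ energy N x := by
  refine Finset.sum_le_sum fun i _ => Finset.sum_le_sum fun j _ => ?_
  simp only [network, Finset.mem_filter, Finset.mem_univ, true_and]
  have := norm_nonneg (x i - x j)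
  split_ifs <;> nlinarith

theorem energy_add (N : Fin n → Finset (Fin n)) (x u : Config n d) :
    energy N (x + u) = energy N x + 2 * dirichlet N x u + dirichlet N u u := by
  simp only [energy, dirichlet, Finset.mul_sum, ← Finset.sum_add_distrib]
  refine Finset.sum_congr rfl fun i _ => Finset.sum_congr rfl fun j _ => ?_
  split_ifs
  · rw [Pi.add_apply, Pi.add_apply, add_sub_add_comm, norm_add_sq_real,
      real_inner_self_eq_norm_sq]
  · ring

/-- Green's identity: against a displacement of the mobile agents only, the Dirichlet form of `x`
sees nothing but the move of one averaging step. -/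
theorem IsNetwork.dirichlet_eq {N : Fin n → Finset (Fin n)} (hN : IsNetwork N)
    {C : Finset (Fin n)} (x : Config n d) {u : Config n d} (hu : ∀ i ∈ C, u i = 0) :
    dirichlet N x u =
      -2 * ∑ i, ((N i).card : ℝ) * inner ℝ (average C N x i - x i) (u i) := by
  have h1 : dirichlet N x u =
      (∑ i, ∑ j, if j ∈ N i then inner ℝ (x i - x j) (u i) else 0) +
      ∑ i, ∑ j, if j ∈ N i then inner ℝ (x j - x i) (u j) else 0 := by
    simp only [dirichlet, ← Finset.sum_add_distrib]
    refine Finset.sum_congr rfl fun i _ => Finset.sum_congr rfl fun j _ => ?_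
    split_ifs
    · rw [inner_sub_right, ← neg_sub (x i) (x j), inner_neg_left, sub_eq_add_neg]
    · simp
  have h2 : (∑ i, ∑ j, if j ∈ N i then inner ℝ (x j - x i) (u j) else 0) =
      ∑ i, ∑ j, if j ∈ N i then inner ℝ (x i - x j) (u i) else 0 := by
    rw [Finset.sum_comm]
    simp only [hN.mem_comm]
  rw [h1, h2, ← two_mul, neg_mul, ← mul_neg, ← Finset.sum_neg_distrib]
  congr 1
  refine Finset.sum_congr rfl fun i _ => ?_
  by_cases hi : i ∈ C
  · simp [hu i hi]
  · have h3 : (∑ j, if j ∈ N i then inner ℝ (x i - x j) (u i) else 0) =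
        inner ℝ (∑ j, if j ∈ N i then x i - x j else 0) (u i) := by
      rw [sum_inner]
      refine Finset.sum_congr rfl fun j _ => ?_
      split_ifs <;> simp
    rw [h3, hN.sum_sub hi, inner_smul_left]
    simp

/-- One averaging step along a fixed network lowers its energy. The self-loops in the neighbor
sets are what makes the gain bounded below. -/
theorem IsNetwork.energy_average_le {N : Fin n → Finset (Fin n)} (hN : IsNetwork N)
    (C : Finset (Fin n)) (x : Config n d) :
    energy N (average C N x) ≤ energy N x - 4 * ∑ i, ‖average C N x i - x i‖ ^ 2 := by
  set u : Config n d := average C N x - x with hu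
  have hu0 : ∀ i ∈ C, u i = 0 := fun i hi => by simp [hu, average_of_mem hi]
  have hx : average C N x = x + u := by simp [hu]
  have hB : dirichlet N x u = -2 * ∑ i, ((N i).card : ℝ) * ‖u i‖ ^ 2 := by
    rw [hN.dirichlet_eq x hu0]
    congr 1
    refine Finset.sum_congr rfl fun i _ => ?_
    rw [← real_inner_self_eq_norm_sq]
    rfl
  -- The diagonal terms of the Dirichlet form vanish, which saves `2 * (‖u i‖² + ‖u i‖²)` each.
  have hU : dirichlet N u u ≤
      ∑ i, ∑ j, ((if j ∈ N i then 2 * (‖u i‖ ^ 2 + ‖u j‖ ^ 2) else 0) -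
        if i = j then 4 * ‖u i‖ ^ 2 else 0) := by
    refine Finset.sum_le_sum fun i _ => Finset.sum_le_sum fun j _ => ?_
    by_cases hij : i = j
    · subst hij
      simp [hN.self_mem i]
      linarith
    · simp only [hij, if_false, sub_zero]
      split_ifs
      · rw [real_inner_self_eq_norm_sq, norm_sub_sq_real]
        have := norm_add_sq_real (u i) (u j)
        nlinarith [sq_nonneg ‖u i + u j‖]
      · exact le_rfl
  have hS : (∑ i, ∑ j, ((if j ∈ N i then 2 * (‖u i‖ ^ 2 + ‖u j‖ ^ 2) else 0) -
        if i = j then 4 * ‖u i‖ ^ 2 else 0)) =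
      4 * (∑ i, ((N i).card : ℝ) * ‖u i‖ ^ 2) - 4 * ∑ i, ‖u i‖ ^ 2 := by
    have h1 : (∑ i, ∑ j, if j ∈ N i then ‖u i‖ ^ 2 else 0) =
        ∑ i, ((N i).card : ℝ) * ‖u i‖ ^ 2 := by
      refine Finset.sum_congr rfl fun i _ => ?_
      rw [Finset.sum_ite_mem, Finset.univ_inter, Finset.sum_const, nsmul_eq_mul]
    have h2 : (∑ i, ∑ j, if j ∈ N i then ‖u j‖ ^ 2 else 0) =
        ∑ i, ((N i).card : ℝ) * ‖u i‖ ^ 2 := by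
      rw [← h1, Finset.sum_comm]
      simp only [hN.mem_comm]
    have h3 : (∑ i, ∑ j, if j ∈ N i then 2 * (‖u i‖ ^ 2 + ‖u j‖ ^ 2) else 0) =
        2 * ((∑ i, ∑ j, if j ∈ N i then ‖u i‖ ^ 2 else 0) +
          ∑ i, ∑ j, if j ∈ N i then ‖u j‖ ^ 2 else 0) := by
      simp only [← Finset.sum_add_distrib, Finset.mul_sum]
      refine Finset.sum_congr rfl fun i _ => Finset.sum_congr rfl fun j _ => ?_
      split_ifs <;> ring
    simp only [Finset.sum_sub_distrib]
    rw [h3, h1, h2, Finset.mul_sum (f := fun i => ‖u i‖ ^ 2)]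
    simp
    ring
  have hsum : ∑ i, ‖average C N x i - x i‖ ^ 2 = ∑ i, ‖u i‖ ^ 2 := rfl
  rw [hsum, hx, energy_add]
  linarith

/-! ### A Polyak-Łojasiewicz inequality for the energy -/

/-- The values of a linear map between finite-dimensional spaces have preimages of controlled
size. -/
theorem exists_preimage_norm_le {V W : Type*} [NormedAddCommGroup V] [NormedSpace ℝ V]
    [NormedAddCommGroup W] [NormedSpace ℝ W] [FiniteDimensional ℝ W] (f : V →ₗ[ℝ] W) :
    ∃ K : ℝ, 0 ≤ K ∧ ∀ v, ∃ v', f v' = f v ∧ ‖v'‖ ≤ K * ‖f v‖ := by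
  obtain ⟨g, hg⟩ := f.rangeRestrict.exists_rightInverse_of_surjective f.range_rangeRestrict
  obtain ⟨K, hK, hgK⟩ := (LinearMap.toContinuousLinearMap g).bound
  exact ⟨K, hK.le, fun v => ⟨g (f.rangeRestrict v),
    congrArg Subtype.val (LinearMap.congr_fun hg (f.rangeRestrict v)), hgK (f.rangeRestrict v)⟩⟩

/-- The displacements that leave the agents in `C` in place. -/
def fixing (C : Finset (Fin n)) : Submodule ℝ (Config n d) where
  carrier := {u | ∀ i ∈ C, u i = 0}
  add_mem' hu hv i hi := by simp [hu i hi, hv i hi]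
  zero_mem' _ _ := rfl
  smul_mem' a u hu i hi := by simp [hu i hi]

/-- The differences of a configuration along the edges of `N`. -/
def edgeDiff (N : Fin n → Finset (Fin n)) :
    Config n d →ₗ[ℝ] (Fin n × Fin n → Space d) where
  toFun u p := if p.2 ∈ N p.1 then u p.1 - u p.2 else 0
  map_add' u v := by
    ext1 p
    by_cases h : p.2 ∈ N p.1 <;> simp [h, add_sub_add_comm]
  map_smul' a u := by
    ext1 p
    by_cases h : p.2 ∈ N p.1 <;> simp [h, smul_sub]

theorem dirichlet_eq_edgeDiff (N : Fin n → Finset (Fin n)) (x u : Config n d) :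
    dirichlet N x u = ∑ p, inner ℝ (edgeDiff N x p) (edgeDiff N u p) := by
  rw [Fintype.sum_prod_type]
  refine Finset.sum_congr rfl fun i _ => Finset.sum_congr rfl fun j _ => ?_
  by_cases h : j ∈ N i <;> simp [edgeDiff, h]

theorem norm_edgeDiff_sq_le (N : Fin n → Finset (Fin n)) (u : Config n d) :
    ‖edgeDiff N u‖ ^ 2 ≤ dirichlet N u u := by
  rw [dirichlet_eq_edgeDiff]
  simp only [real_inner_self_eq_norm_sq]
  have h0 : 0 ≤ ∑ p, ‖edgeDiff N u p‖ ^ 2 := Finset.sum_nonneg fun p _ => sq_nonneg _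
  rw [← Real.le_sqrt (norm_nonneg _) h0, pi_norm_le_iff_of_nonneg (Real.sqrt_nonneg _)]
  intro p
  rw [Real.le_sqrt (norm_nonneg _) h0]
  exact Finset.single_le_sum (f := fun p => ‖edgeDiff N u p‖ ^ 2) (fun p _ => sq_nonneg _)
    (Finset.mem_univ p)

/-- As a quadratic function of the mobile agents, the energy exceeds its infimum by at most a
constant times the squared move of one averaging step. The infimum is replaced here by an arbitrary
competitor `x'`. -/
theorem IsNetwork.exists_energy_sub_le {N : Fin n → Finset (Fin n)} (hN : IsNetwork N)
    (C : Finset (Fin n)) :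
    ∃ K : ℝ, ∀ x x' : Config n d, (∀ i ∈ C, x i = x' i) →
      energy N x - energy N x' ≤ K * ∑ i, ‖average C N x i - x i‖ ^ 2 := by
  obtain ⟨K, hK, hpre⟩ :=
    exists_preimage_norm_le ((edgeDiff N).comp (fixing (d := d) C).subtype)
  refine ⟨(2 * n * K) ^ 2 * n, fun x x' hxx' => ?_⟩
  set D := ∑ i, ‖average C N x i - x i‖ with hD
  have hu : x - x' ∈ fixing C := fun i hi => by simp [hxx' i hi]
  obtain ⟨⟨v, hv⟩, hvu, hvn⟩ := hpre ⟨x - x', hu⟩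
  simp only [LinearMap.comp_apply, Submodule.subtype_apply] at hvu hvn
  set s := ‖edgeDiff N (x - x')‖ with hs
  have hs0 : 0 ≤ s := norm_nonneg _
  have hv' : ‖v‖ ≤ K * s := hvn
  have hdir : dirichlet N x (x - x') = dirichlet N x v := by
    rw [dirichlet_eq_edgeDiff, dirichlet_eq_edgeDiff, hvu]
  have hle : dirichlet N x v ≤ 2 * (n * D * (K * s)) := by
    rw [hN.dirichlet_eq x hv, neg_mul, ← mul_neg, ← Finset.sum_neg_distrib, hD,
      Finset.mul_sum (f := fun i => ‖average C N x i - x i‖), Finset.sum_mul]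
    refine mul_le_mul_of_nonneg_left (Finset.sum_le_sum fun i _ => ?_) zero_le_two
    have hcard : ((N i).card : ℝ) ≤ n := by
      exact_mod_cast (Finset.card_le_univ (N i)).trans_eq (Fintype.card_fin n)
    calc -(((N i).card : ℝ) * inner ℝ (average C N x i - x i) (v i))
        = ((N i).card : ℝ) * -inner ℝ (average C N x i - x i) (v i) := by ring
      _ ≤ ((N i).card : ℝ) * (‖average C N x i - x i‖ * ‖v i‖) := by
          refine mul_le_mul_of_nonneg_left ?_ (Nat.cast_nonneg _)
          exact (neg_le_abs _).trans (abs_real_inner_le_norm _ _)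
      _ ≤ n * (‖average C N x i - x i‖ * (K * s)) := by
          have := (norm_le_pi_norm v i).trans hv'
          gcongr
      _ = n * ‖average C N x i - x i‖ * (K * s) := by ring
  have hexp := energy_add N x (-(x - x'))
  have h1 (w : Config n d) : dirichlet N x (-w) = -dirichlet N x w := by
    simp [dirichlet_eq_edgeDiff]
  have h2 (w : Config n d) : dirichlet N (-w) (-w) = dirichlet N w w := by
    simp [dirichlet_eq_edgeDiff]
  rw [h1, h2, show x + -(x - x') = x' by abel] at hexp
  have h3 := norm_edgeDiff_sq_le N (x - x')
  have h4 : D ^ 2 ≤ n * ∑ i, ‖average C N x i - x i‖ ^ 2 := by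
    simpa using sq_sum_le_card_mul_sum_sq (s := Finset.univ)
      (f := fun i => ‖average C N x i - x i‖)
  calc energy N x - energy N x' ≤ 2 * (2 * n * K * D) * s - s ^ 2 := by
        rw [hdir] at hexp
        nlinarith
    _ ≤ (2 * n * K) ^ 2 * D ^ 2 := by nlinarith [sq_nonneg (2 * n * K * D - s)]
    _ ≤ (2 * n * K) ^ 2 * (n * ∑ i, ‖average C N x i - x i‖ ^ 2) := by gcongr
    _ = _ := by ring

/-- The constant of `IsNetwork.exists_energy_sub_le` can be chosen uniformly, there being only
finitely many networks on `n` agents. -/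
theorem exists_energy_sub_le (d : ℕ) (C : Finset (Fin n)) :
    ∃ K : ℝ, 0 < K ∧ ∀ N : Fin n → Finset (Fin n), IsNetwork N → ∀ x x' : Config n d,
      (∀ i ∈ C, x i = x' i) →
        energy N x - energy N x' ≤ K * ∑ i, ‖average C N x i - x i‖ ^ 2 := by
  have h (N : Fin n → Finset (Fin n)) : ∃ K : ℝ, IsNetwork N → ∀ x x' : Config n d,
      (∀ i ∈ C, x i = x' i) →
        energy N x - energy N x' ≤ K * ∑ i, ‖average C N x i - x i‖ ^ 2 := by
    by_cases hN : IsNetwork N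
    · obtain ⟨K, hK⟩ := hN.exists_energy_sub_le (d := d) C
      exact ⟨K, fun _ => hK⟩
    · exact ⟨0, fun h => absurd h hN⟩
  choose K hK using h
  refine ⟨1 + ∑ N, |K N|, by positivity, fun N hN x x' hxx' => (hK N hN x x' hxx').trans ?_⟩
  refine mul_le_mul_of_nonneg_right ?_ (Finset.sum_nonneg fun i _ => sq_nonneg _)
  have := Finset.single_le_sum (f := fun N => |K N|) (fun N _ => abs_nonneg _)
    (Finset.mem_univ N)
  linarith [le_abs_self (K N)]

/-! ### Convergence of the trajectory -/

theorem trajectory_succ (C : Finset (Fin n)) (x₀ : Config n d) (t : ℕ) :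
    trajectory C x₀ (t + 1) =
      average C (network (trajectory C x₀ t)) (trajectory C x₀ t) := by
  rw [trajectory, Function.iterate_succ_apply']
  rfl

theorem trajectory_of_mem {C : Finset (Fin n)} {i : Fin n} (hi : i ∈ C) (x₀ : Config n d)
    (t : ℕ) : trajectory C x₀ t i = x₀ i := by
  induction t with
  | zero => rfl
  | succ t ih => rw [trajectory_succ, average_of_mem hi, ih]

/-- The network `N` occurs at arbitrarily late times. -/
def Recurs (C : Finset (Fin n)) (x₀ : Config n d) (N : Fin n → Finset (Fin n)) : Prop :=
  ∃ᶠ t in Filter.atTop, network (trajectory C x₀ t) = N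

theorem Recurs.isNetwork {C : Finset (Fin n)} {x₀ : Config n d} {N : Fin n → Finset (Fin n)}
    (h : Recurs C x₀ N) : IsNetwork N := by
  obtain ⟨t, rfl⟩ := Filter.Frequently.exists h
  exact isNetwork_network _

/-- A network that does not recur dies out, and there are finitely many. -/
theorem eventually_recurs (C : Finset (Fin n)) (x₀ : Config n d) :
    ∀ᶠ t in Filter.atTop, Recurs C x₀ (network (trajectory C x₀ t)) := by
  have h : ∀ᶠ t in Filter.atTop, ∀ N : Fin n → Finset (Fin n),
      ¬Recurs C x₀ N → network (trajectory C x₀ t) ≠ N := by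
    rw [Filter.eventually_all]
    intro N
    by_cases hN : Recurs C x₀ N
    · simp [hN]
    · exact (Filter.not_frequently.mp hN).mono fun t ht _ => ht
  filter_upwards [h] with t ht
  by_contra hN
  exact ht _ hN rfl

/-- A nonnegative sequence whose excess over all its later terms is at most a multiple of its next
decrement decays geometrically to its limit; only the decrements are recorded. -/
theorem exists_sub_le_geometric {e : ℕ → ℝ} (he : Antitone e) (he0 : ∀ t, 0 ≤ e t) {K : ℝ}
    (hK : 1 < K) {T : ℕ} (h : ∀ t ≥ T, ∀ s, e t - e s ≤ K * (e t - e (t + 1))) :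
    ∃ A r : ℝ, 0 ≤ A ∧ 0 < r ∧ r < 1 ∧ ∀ t, e (T + t) - e (T + t + 1) ≤ A * r ^ t := by
  have hbdd : BddBelow (Set.range e) := ⟨0, by rintro _ ⟨t, rfl⟩; exact he0 t⟩
  have hlim := tendsto_atTop_ciInf he hbdd
  set L := ⨅ t, e t with hL
  have hLe : ∀ t, L ≤ e t := fun t => ciInf_le hbdd t
  have hstep : ∀ t ≥ T, e t - L ≤ K * (e t - e (t + 1)) := fun t ht =>
    le_of_tendsto (hlim.const_sub (e t)) (Filter.Eventually.of_forall (h t ht))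
  have hK0 : 0 < K := by linarith
  have hr : K⁻¹ < 1 := inv_lt_one_of_one_lt₀ hK
  have hgeo : ∀ t, e (T + t) - L ≤ (e T - L) * (1 - K⁻¹) ^ t := by
    intro t
    induction t with
    | zero => simp
    | succ t ih =>
      have h1 : K⁻¹ * (e (T + t) - L) ≤ e (T + t) - e (T + t + 1) := by
        rw [inv_mul_le_iff₀ hK0]
        exact hstep _ (Nat.le_add_right _ _)
      have h2 : e (T + (t + 1)) - L ≤ (1 - K⁻¹) * (e (T + t) - L) := by
        rw [← add_assoc]
        linarith
      calc _ ≤ _ := h2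
        _ ≤ (1 - K⁻¹) * ((e T - L) * (1 - K⁻¹) ^ t) :=
            mul_le_mul_of_nonneg_left ih (by linarith)
        _ = _ := by ring
  refine ⟨e T - L, 1 - K⁻¹, by linarith [hLe T], by linarith, by linarith [inv_pos.mpr hK0],
    fun t => ?_⟩
  linarith [hgeo t, hLe (T + t + 1)]

/-- Every trajectory converges, at a geometric rate: once only recurring networks are left, the
energy of the trajectory satisfies the hypothesis of `exists_sub_le_geometric`, since the energies
of later returns to the same network are competitors in the Polyak-Łojasiewicz inequality. -/
theorem exists_tendsto_trajectory (C : Finset (Fin n)) (x₀ : Config n d) :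
    ∃ z, Filter.Tendsto (trajectory C x₀) Filter.atTop (nhds z) := by
  set x := trajectory C x₀ with hx
  set e : ℕ → ℝ := fun t => energy (network (x t)) (x t) with he
  obtain ⟨K, hK, hPL⟩ := exists_energy_sub_le d C
  have hdrop : ∀ t, 4 * ∑ i, ‖x (t + 1) i - x t i‖ ^ 2 ≤ e t - e (t + 1) := by
    intro t
    have h1 := (isNetwork_network (x t)).energy_average_le C (x t)
    have h2 := energy_network_le (network (x t)) (x (t + 1))
    rw [← trajectory_succ] at h1
    simp only [he]
    linarith
  have hanti : Antitone e := antitone_nat_of_succ_le fun t => by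
    have := hdrop t
    have : 0 ≤ ∑ i, ‖x (t + 1) i - x t i‖ ^ 2 := Finset.sum_nonneg fun i _ => sq_nonneg _
    linarith
  obtain ⟨T, hT⟩ := Filter.eventually_atTop.mp (eventually_recurs C x₀)
  have hexcess : ∀ t ≥ T, ∀ s, e t - e s ≤ (K + 1) * (e t - e (t + 1)) := by
    intro t ht s
    obtain ⟨s', hs', hN⟩ := (Filter.frequently_atTop.mp (hT t ht)) s
    have h1 := hPL _ (isNetwork_network (x t)) (x t) (x s') fun i hi => by
      rw [hx, trajectory_of_mem hi, trajectory_of_mem hi]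
    rw [← trajectory_succ] at h1
    have h2 : energy (network (x t)) (x s') = e s' := by rw [← hN]
    rw [h2] at h1
    have h3 := hanti hs'
    have h4 := hdrop t
    have h5 := hanti (Nat.le_succ t)
    have h6 : K * ∑ i, ‖x (t + 1) i - x t i‖ ^ 2 ≤ K * (e t - e (t + 1)) := by
      refine mul_le_mul_of_nonneg_left ?_ hK.le
      have : 0 ≤ ∑ i, ‖x (t + 1) i - x t i‖ ^ 2 := Finset.sum_nonneg fun i _ => sq_nonneg _
      linarith
    have h7 : e t - e s' ≤ K * ∑ i, ‖x (t + 1) i - x t i‖ ^ 2 := h1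
    simp only [Nat.succ_eq_add_one] at h5
    linarith
  obtain ⟨A, r, hA, hr0, hr1, hAr⟩ := exists_sub_le_geometric hanti
    (fun t => energy_nonneg _ _) (by linarith : (1 : ℝ) < K + 1) hexcess
  have hcauchy : CauchySeq fun t => x (t + T) := by
    refine cauchySeq_of_le_geometric (√r) (√A) ?_ fun t => ?_
    · rw [Real.sqrt_lt' one_pos]
      simpa using hr1
    rw [dist_pi_le_iff (by positivity)]
    intro i
    rw [dist_comm, dist_eq_norm]
    refine (pow_le_pow_iff_left₀ (norm_nonneg _) (by positivity) two_ne_zero).mp ?_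
    have h1 := hdrop (T + t)
    have h2 := Finset.single_le_sum (f := fun i => ‖x (T + t + 1) i - x (T + t) i‖ ^ 2)
      (fun i _ => sq_nonneg _) (Finset.mem_univ i)
    have h3 := hAr t
    have h4 : 0 ≤ ‖x (T + t + 1) i - x (T + t) i‖ ^ 2 := sq_nonneg _
    rw [mul_pow, Real.sq_sqrt hA, ← pow_mul, mul_comm t 2, pow_mul, Real.sq_sqrt hr0.le,
      show t + 1 + T = T + t + 1 by ring, add_comm t T]
    linarith
  obtain ⟨z, hz⟩ := cauchySeq_tendsto_of_complete hcauchy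
  exact ⟨z, (Filter.tendsto_add_atTop_iff_nat T).mp hz⟩

theorem Recurs.average_eq {C : Finset (Fin n)} {x₀ z : Config n d}
    {N : Fin n → Finset (Fin n)} (h : Recurs C x₀ N)
    (hz : Filter.Tendsto (trajectory C x₀) Filter.atTop (nhds z)) : average C N z = z := by
  have hcont : Continuous (average (d := d) C N) :=
    (averageMap C N).continuous_of_finiteDimensional
  have hclosed : IsClosed {p : Config n d × Config n d | average C N p.1 = p.2} :=
    isClosed_eq (hcont.comp continuous_fst) continuous_snd
  have hz' : Filter.Tendsto (fun t => (trajectory C x₀ t, trajectory C x₀ (t + 1)))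
      Filter.atTop (nhds (z, z)) :=
    hz.prodMk_nhds ((Filter.tendsto_add_atTop_iff_nat 1).mpr hz)
  refine hclosed.mem_of_frequently_of_tendsto (h.mono fun t ht => ?_) hz'
  simp only [Set.mem_ofPred_eq, trajectory_succ, ht]

theorem networkConverges_of_recurs_unique {C : Finset (Fin n)} {x₀ : Config n d}
    (h : ∀ N N', Recurs C x₀ N → Recurs C x₀ N' → N = N') : NetworkConverges C x₀ := by
  obtain ⟨T, hT⟩ := Filter.eventually_atTop.mp (eventually_recurs C x₀)
  exact ⟨network (trajectory C x₀ T), T, fun t ht => h _ _ (hT t ht) (hT T le_rfl)⟩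

/-! ### Dimension one -/

/-- Two networks that have `z` as a common fixed point and that are the networks of configurations
`x` and `x'` near `z`, with the same closed-minded agents, coincide in dimension one. The
difference of their Dirichlet forms at `z` and `x' - x` vanishes, by Green's identity. On the line
each summand has a sign: an edge that is gained gets shorter, an edge that is lost gets longer. -/
theorem network_eq_of_average_eq {C : Finset (Fin n)} {x x' z : Config n 1}
    (hC : ∀ i ∈ C, x i = x' i) (hx : ∀ i, ‖x i - z i‖ < 1 / 4) (hx' : ∀ i, ‖x' i - z i‖ < 1 / 4)
    (hz : average C (network x) z = z) (hz' : average C (network x') z = z) :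
    network x = network x' := by
  have norm_eq (v : Space 1) : ‖v‖ = |v 0| := by
    simp [EuclideanSpace.norm_eq, Real.sqrt_sq_eq_abs]
  have inner_eq (v w : Space 1) : inner ℝ v w = v 0 * w 0 := by
    simp [PiLp.inner_apply, mul_comm]
  have hu : ∀ i ∈ C, (x' - x) i = 0 := fun i hi => by simp [hC i hi]
  have hG : dirichlet (network x) z (x' - x) = 0 := by
    simp [(isNetwork_network x).dirichlet_eq z hu, hz]
  have hG' : dirichlet (network x') z (x' - x) = 0 := by
    simp [(isNetwork_network x').dirichlet_eq z hu, hz']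
  set a : Fin n → Fin n → ℝ := fun i j =>
    (if j ∈ network x i then inner ℝ (z i - z j) ((x' - x) i - (x' - x) j) else 0) -
    if j ∈ network x' i then inner ℝ (z i - z j) ((x' - x) i - (x' - x) j) else 0 with ha
  have hsum : ∑ i, ∑ j, a i j = 0 := by
    have : ∑ i, ∑ j, a i j =
        dirichlet (network x) z (x' - x) - dirichlet (network x') z (x' - x) := by
      simp only [ha, dirichlet, Finset.sum_sub_distrib]
    rw [this, hG, hG', sub_zero]
  have hpos : ∀ i j, 0 ≤ a i j ∧ (a i j = 0 → (j ∈ network x i ↔ j ∈ network x' i)) := by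
    intro i j
    have h1 := hx i
    have h2 := hx j
    have h3 := hx' i
    have h4 := hx' j
    simp only [ha, network, Finset.mem_filter, Finset.mem_univ, true_and, norm_eq, inner_eq,
      PiLp.sub_apply, Pi.sub_apply] at h1 h2 h3 h4 ⊢
    rw [abs_lt] at h1 h2 h3 h4
    generalize x i 0 = p at *
    generalize x j 0 = q at *
    generalize x' i 0 = p' at *
    generalize x' j 0 = q' at *
    generalize z i 0 = b at *
    generalize z j 0 = c at *
    by_cases k : |p - q| ≤ 1 <;> by_cases k' : |p' - q'| ≤ 1
    · simp [k, k']
    · -- a lost edge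
      simp only [k, k', if_true, if_false, sub_zero]
      rw [abs_le] at k
      have : 0 < (b - c) * (p' - p - (q' - q)) := by
        rcases lt_abs.mp (not_le.mp k') with h | h
        · exact mul_pos (by linarith) (by linarith)
        · exact mul_pos_of_neg_of_neg (by linarith) (by linarith)
      exact ⟨this.le, fun h => absurd h this.ne'⟩
    · -- a gained edge
      simp only [k, k', if_true, if_false, zero_sub]
      rw [abs_le] at k'
      have : 0 < -((b - c) * (p' - p - (q' - q))) := by
        rw [← mul_neg]
        rcases lt_abs.mp (not_le.mp k) with h | h
        · exact mul_pos (by linarith) (by linarith)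
        · exact mul_pos_of_neg_of_neg (by linarith) (by linarith)
      exact ⟨this.le, fun h => absurd h this.ne'⟩
    · simp [k, k']
  have hzero : ∀ i j, a i j = 0 := by
    intro i j
    have h1 := (Finset.sum_eq_zero_iff_of_nonneg
      (fun i _ => Finset.sum_nonneg fun j _ => (hpos i j).1)).mp hsum i (Finset.mem_univ i)
    exact (Finset.sum_eq_zero_iff_of_nonneg (fun j _ => (hpos i j).1)).mp h1 j
      (Finset.mem_univ j)
  ext i j
  exact (hpos i j).2 (hzero i j)

theorem networkConverges_line (C : Finset (Fin n)) (x₀ : Config n 1) : NetworkConverges C x₀ := by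
  obtain ⟨z, hz⟩ := exists_tendsto_trajectory C x₀
  have hnear : ∀ᶠ t in Filter.atTop, ∀ i, ‖trajectory C x₀ t i - z i‖ < 1 / 4 := by
    rw [Filter.eventually_all]
    intro i
    have := (tendsto_pi_nhds.mp hz i).eventually (Metric.ball_mem_nhds (z i) (by norm_num :
      (0 : ℝ) < 1 / 4))
    exact this.mono fun t ht => by rwa [dist_eq_norm] at ht
  refine networkConverges_of_recurs_unique fun N N' hN hN' => ?_
  obtain ⟨t, rfl, ht⟩ := (Filter.Frequently.and_eventually hN hnear).exists
  obtain ⟨t', rfl, ht'⟩ := (Filter.Frequently.and_eventually hN' hnear).exists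
  exact network_eq_of_average_eq
    (fun i hi => by rw [trajectory_of_mem hi, trajectory_of_mem hi]) ht ht'
    (hN.average_eq hz) (hN'.average_eq hz)

/-! ### Generic positions of the closed-minded agents -/

/-- At a fixed point of averaging, the difference along an edge is determined, linearly, by the
positions of the closed-minded agents: if these are all at the origin, then the Dirichlet form
vanishes, by Green's identity. -/
theorem IsNetwork.exists_linearMap_eq_sub {N : Fin n → Finset (Fin n)} (hN : IsNetwork N)
    (d : ℕ) (C : Finset (Fin n)) {i j : Fin n} (hij : j ∈ N i) :
    ∃ f : (C → Space d) →ₗ[ℝ] Space d, ∀ z : Config n d, average C N z = z →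
      f (fun k => z k) = z i - z j := by
  let F : Submodule ℝ (Config n d) := LinearMap.eqLocus (averageMap C N) LinearMap.id
  let res : F →ₗ[ℝ] (C → Space d) :=
    (LinearMap.funLeft ℝ (Space d) (fun k : C => (k : Fin n))).comp F.subtype
  let diff : F →ₗ[ℝ] Space d :=
    (LinearMap.proj (R := ℝ) (φ := fun _ : Fin n => Space d) i -
      LinearMap.proj (R := ℝ) (φ := fun _ : Fin n => Space d) j).comp F.subtype
  have hker : LinearMap.ker res ≤ LinearMap.ker diff := by
    rintro ⟨z, hz⟩ h
    have hz' : average C N z = z := hz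
    have h0 : ∀ k ∈ C, z k = 0 := fun k hk => congrFun (LinearMap.mem_ker.mp h) ⟨k, hk⟩
    have hdir : dirichlet N z z = 0 := by simp [hN.dirichlet_eq z h0, hz']
    have hnorm := norm_edgeDiff_sq_le N z
    rw [hdir] at hnorm
    have h1 : edgeDiff N z = 0 := norm_eq_zero.mp (pow_eq_zero_iff two_ne_zero |>.mp
      (le_antisymm hnorm (sq_nonneg _)))
    have h2 := congrFun h1 (i, j)
    rw [LinearMap.mem_ker]
    simpa [edgeDiff, diff, hij] using h2
  obtain ⟨f, hf⟩ := LinearMap.exists_extend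
    ((LinearMap.ker res).liftQ diff hker ∘ₗ res.quotKerEquivRange.symm.toLinearMap)
  refine ⟨f, fun z hz => ?_⟩
  have h1 := LinearMap.congr_fun hf (res.rangeRestrict ⟨z, hz⟩)
  have h2 : res.quotKerEquivRange.symm (res.rangeRestrict ⟨z, hz⟩) =
      Submodule.Quotient.mk ⟨z, hz⟩ := by
    rw [LinearEquiv.symm_apply_eq]
    rfl
  simp only [LinearMap.comp_apply, LinearEquiv.coe_coe, h2] at h1
  exact h1

/-- The level set `{v | ‖f v‖ = 1}` of a linear map bounds a convex set. -/
theorem ae_norm_ne_one {V W : Type*} [NormedAddCommGroup V] [NormedSpace ℝ V]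
    [MeasurableSpace V] [BorelSpace V] [FiniteDimensional ℝ V]
    (μ : MeasureTheory.Measure V) [μ.IsAddHaarMeasure]
    [NormedAddCommGroup W] [NormedSpace ℝ W] (f : V →ₗ[ℝ] W) : ∀ᵐ v ∂μ, ‖f v‖ ≠ 1 := by
  have hconv : Convex ℝ {v | ‖f v‖ ≤ 1} := by
    have := (convex_closedBall (0 : W) 1).linear_preimage f
    simpa [Set.preimage, Metric.closedBall] using this
  rw [MeasureTheory.ae_iff]
  refine MeasureTheory.measure_mono_null (fun v hv => ?_) (hconv.addHaar_frontier μ)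
  have hv1 : ‖f v‖ = 1 := by simpa using hv
  refine ⟨subset_closure hv1.le, fun hint => ?_⟩
  have hcont : Filter.Tendsto (fun a : ℝ => a • v) (nhdsWithin 1 (Set.Ioi 1)) (nhds v) := by
    have : Continuous fun a : ℝ => a • v := by fun_prop
    simpa using (this.tendsto 1).mono_left nhdsWithin_le_nhds
  obtain ⟨a, ha, ha1⟩ := ((hcont.eventually (mem_interior_iff_mem_nhds.mp hint)).and
    self_mem_nhdsWithin).exists
  simp only [map_smul, norm_smul, hv1, mul_one, Real.norm_eq_abs] at ha
  exact absurd ((le_abs_self a).trans ha) (not_le.mpr ha1)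

/-- If no recurring network has an edge of limit length exactly `1`, then its edges are the pairs
of limit distance less than `1`, so that it is unique. -/
theorem networkConverges_of_norm_ne_one {C : Finset (Fin n)} {x₀ z : Config n d}
    (hz : Filter.Tendsto (trajectory C x₀) Filter.atTop (nhds z))
    (h : ∀ N, Recurs C x₀ N → ∀ i, ∀ j ∈ N i, ‖z i - z j‖ ≠ 1) : NetworkConverges C x₀ := by
  have hlim (i j : Fin n) : Filter.Tendsto
      (fun t => ‖trajectory C x₀ t i - trajectory C x₀ t j‖) Filter.atTop
      (nhds ‖z i - z j‖) :=
    ((tendsto_pi_nhds.mp hz i).sub (tendsto_pi_nhds.mp hz j)).norm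
  have key : ∀ N, Recurs C x₀ N → ∀ i j, j ∈ N i ↔ ‖z i - z j‖ < 1 := by
    intro N hN i j
    constructor
    · intro hij
      refine lt_of_le_of_ne ?_ (h N hN i j hij)
      refine isClosed_Iic.mem_of_frequently_of_tendsto (hN.mono fun t ht => ?_) (hlim i j)
      rw [← ht] at hij
      simpa [network] using hij
    · intro hij
      obtain ⟨t, rfl, ht⟩ := (Filter.Frequently.and_eventually hN
        ((hlim i j).eventually (gt_mem_nhds hij))).exists
      simpa [network] using ht.le
  refine networkConverges_of_recurs_unique fun N N' hN hN' => ?_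
  ext i j
  rw [key N hN, key N' hN']

/-- Whether the network converges can be read off generically from the closed-minded agents alone:
finitely many linear maps have to avoid the unit sphere there. -/
theorem exists_linearMaps_networkConverges (d : ℕ) (C : Finset (Fin n)) :
    ∃ f : (Fin n → Finset (Fin n)) → Fin n → Fin n → (C → Space d) →ₗ[ℝ] Space d,
      ∀ x₀ : Config n d, (∀ N i j, ‖f N i j (fun k => x₀ k)‖ ≠ 1) → NetworkConverges C x₀ := by
  have h (N : Fin n → Finset (Fin n)) (i j : Fin n) : ∃ f : (C → Space d) →ₗ[ℝ] Space d,
      IsNetwork N → j ∈ N i → ∀ z : Config n d, average C N z = z →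
        f (fun k => z k) = z i - z j := by
    by_cases hN : IsNetwork N ∧ j ∈ N i
    · obtain ⟨f, hf⟩ := hN.1.exists_linearMap_eq_sub d C hN.2
      exact ⟨f, fun _ _ => hf⟩
    · exact ⟨0, fun h1 h2 => absurd ⟨h1, h2⟩ hN⟩
  choose f hf using h
  refine ⟨f, fun x₀ hx₀ => ?_⟩
  obtain ⟨z, hz⟩ := exists_tendsto_trajectory C x₀
  refine networkConverges_of_norm_ne_one hz fun N hN i j hij => ?_
  have hzC : (fun k : C => z k) = fun k : C => x₀ k := by
    ext1 k
    refine tendsto_nhds_unique (tendsto_pi_nhds.mp hz k) ?_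
    simp only [trajectory_of_mem k.2]
    exact tendsto_const_nhds
  rw [← hf N i j hN.isNetwork hij z (hN.average_eq hz), hzC]
  exact hx₀ N i j

theorem ae_networkConverges (C : Finset (Fin n)) :
    ∀ᵐ x₀ : Config n d ∂MeasureTheory.volume, NetworkConverges C x₀ := by
  obtain ⟨f, hf⟩ := exists_linearMaps_networkConverges d C
  have h : ∀ᵐ x₀ : Config n d ∂MeasureTheory.volume, ∀ N i j,
      ‖f N i j (fun k => x₀ k)‖ ≠ 1 := by
    simp only [MeasureTheory.ae_all_iff]
    exact fun N i j => ae_norm_ne_one MeasureTheory.volume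
      ((f N i j).comp (LinearMap.funLeft ℝ (Space d) (fun k : C => (k : Fin n))))
  exact h.mono fun x₀ => hf x₀

theorem ae_networkConverges_replaceClosed (C : Finset (Fin n)) (x₀ : Config n d) :
    ∀ᵐ y : (C → Space d) ∂MeasureTheory.volume, NetworkConverges C (replaceClosed C x₀ y) := by
  obtain ⟨f, hf⟩ := exists_linearMaps_networkConverges d C
  have h : ∀ᵐ y : (C → Space d) ∂MeasureTheory.volume, ∀ N i j, ‖f N i j y‖ ≠ 1 := by
    simp only [MeasureTheory.ae_all_iff]
    exact fun N i j => ae_norm_ne_one MeasureTheory.volume (f N i j)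
  filter_upwards [h] with y hy
  refine hf _ ?_
  have : (fun k : C => replaceClosed C x₀ y k) = y := by
    ext1 k
    simp [replaceClosed]
  rwa [this]

end HK

theorem theorem2 (n d : ℕ) (C : Finset (Fin n)) :
    (∀ x₀ : HK.Config n d, ∃ z : HK.Config n d,
      Filter.Tendsto (HK.trajectory C x₀) Filter.atTop (nhds z) ∧
      ∀ᶠ t in Filter.atTop, HK.average C (HK.network (HK.trajectory C x₀ t)) z = z) ∧
    (d = 1 → ∀ x₀ : HK.Config n d, HK.NetworkConverges C x₀) ∧
    (1 < d →
      (∀ᵐ x₀ : HK.Config n d ∂MeasureTheory.volume, HK.NetworkConverges C x₀) ∧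
      ∀ x₀ : HK.Config n d, ∀ᵐ y : (C → HK.Space d) ∂MeasureTheory.volume,
        HK.NetworkConverges C (HK.replaceClosed C x₀ y)) := by
  refine ⟨fun x₀ => ?_, ?_, fun _ =>
    ⟨HK.ae_networkConverges C, HK.ae_networkConverges_replaceClosed C⟩⟩
  · obtain ⟨z, hz⟩ := HK.exists_tendsto_trajectory C x₀
    exact ⟨z, hz, (HK.eventually_recurs C x₀).mono fun t ht => ht.average_eq hz⟩
  · rintro rfl x₀
    exact HK.networkConverges_line C x₀
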